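/- Let $\alpha\ge 0$ and $\beta>0$ be real, and let $x,p$ be real numbers such that $n+x>0$ and $(n+x)^\beta+p>0$ for all integers $n\ge 1$. Put $$z(s;\alpha,\beta,x,p)=\sum_{n=1}^\infty (n+x)^\alpha\left[(n+x)^\beta+p\right]^{-s},\qquad \Re(s)>\frac{1+\alpha}{\beta}.$$ Let $\zeta_H(s,a)$ denote the analytic continuation of $\sum_{n\ge 0}(n+a)^{-s}$ ($a>0$), $\zeta_H'$ its derivative in $s$, $\Psi=\Gamma'/\Gamma$ and $\gamma$ Euler's constant. The series converges for $\Re(s)>\frac{1+\alpha}{\beta}$, and $z(s)=z(s;\alpha,\beta,x,p)$ has an analytic continuation to the whole complex $s$-plane, regular except for simple poles at those of the points $s=\frac{1+\alpha}{\beta}-j$, $j=0,1,2,\dots$, that are not among $0,-1,-2,\dots$ (if $p=0$, only the pole with $j=0$ is present). In particular $s=0$ is a regular point. For an integer $q\ge 0$ let $$F_q=\prod_{n=1}^\infty\left(1+\frac{p}{(n+x)^\beta}\right)^{(n+x)^\alpha}\exp\left((n+x)^\alpha\sum_{j=1}^{q}\frac{(-1)^j}{j}\frac{p^j}{(n+x)^{\beta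 j}}\right).$$ (i) If $\frac{1+\alpha}{\beta}$ is not a positive integer, let $q=\left\lfloor\frac{1+\alpha}{\beta}\right\rfloor$. Then the product $F_q$ converges to a positive number, and $$z(0)=\zeta_H(-\alpha,x+1),$$ $$z'(0)=\beta\,\zeta_H'(-\alpha,x+1)+\sum_{j=1}^{q}\frac{(-1)^j}{j}\,\zeta_H(\beta j-\alpha,x+1)\,p^j-\log F_q .$$ (ii) If $q=\frac{1+\alpha}{\beta}$ is a positive integer, then the product $F_q$ converges to a positive number, and $$z(0)=\zeta_H(-\alpha,x+1)+\frac{(-1)^q}{\alpha+1}\,p^q,$$ $$z'(0)=\beta\,\zeta_H'(-\alpha,x+1)+\sum_{j=1}^{q-1}\frac{(-1)^j}{j}\,\zeta_H(\beta j-\alpha,x+1)\,p^j+\frac{(-1)^q}{q}\left[-\Psi(x+1)+\frac{\gamma+\Psi(q)}{\beta}\right]p^q-\log F_q .$$ -/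

import Mathlib

/-- The Hurwitz zeta function `ζ_H(s, a)` for an arbitrary real parameter `a > 0`: the analytic
continuation of `∑_{n ≥ 0} (n + a)^{-s}`. Mathlib's `HurwitzZeta.hurwitzZeta a` depends only on
`a` modulo `1` and sums over the positive reals congruent to `a`; the finitely many terms
`a - 1, a - 2, …` that lie in `(0, a)` are removed. See `hasSum_hurwitzZetaPos` and
`differentiableAt_hurwitzZetaPos`. -/
noncomputable def hurwitzZetaPos (s : ℂ) (a : ℝ) : ℂ :=
  HurwitzZeta.hurwitzZeta (a : UnitAddCircle) s
    - ∑ m ∈ Finset.range (⌈a⌉₊ - 1), ((a - 1 - m : ℝ) : ℂ) ^ (-s)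

/-- `ζ_H(s, a) = ∑_{n ≥ 0} (n + a)^{-s}` for `Re s > 1`, `a > 0`. -/
theorem hasSum_hurwitzZetaPos {a : ℝ} (ha : 0 < a) {s : ℂ} (hs : 1 < s.re) :
    HasSum (fun n : ℕ => (((n : ℝ) + a : ℝ) : ℂ) ^ (-s)) (hurwitzZetaPos s a) := by
  obtain ⟨k, hk⟩ : ∃ k : ℕ, ⌈a⌉₊ = k + 1 :=
    ⟨⌈a⌉₊ - 1, by have := Nat.ceil_pos.mpr ha; omega⟩
  have h1 : a ≤ (k : ℝ) + 1 := by
    have := Nat.le_ceil a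
    rw [hk] at this
    exact_mod_cast this
  have h2 : (k : ℝ) < a := by
    have : k < ⌈a⌉₊ := by omega
    exact Nat.lt_ceil.mp this
  have hmem : a - k ∈ Set.Icc (0 : ℝ) 1 := ⟨by linarith, by linarith⟩
  have h := HurwitzZeta.hasSum_hurwitzZeta_of_one_lt_re hmem hs
  have hc : ((a - k : ℝ) : UnitAddCircle) = (a : UnitAddCircle) := by
    rw [AddCircle.coe_sub]
    have : ((k : ℝ) : UnitAddCircle) = 0 := by
      rw [AddCircle.coe_eq_zero_iff]
      exact ⟨k, by simp⟩
    rw [this, sub_zero]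
  rw [hc] at h
  rw [← hasSum_nat_add_iff' k] at h
  have hk' : ⌈a⌉₊ - 1 = k := by omega
  unfold hurwitzZetaPos
  rw [hk', ← Finset.sum_range_reflect]
  have e1 : (fun n : ℕ => (((n : ℝ) + a : ℝ) : ℂ) ^ (-s)) =
      fun n : ℕ => 1 / (((n + k : ℕ) : ℂ) + ((a - k : ℝ) : ℂ)) ^ s := by
    funext n
    rw [one_div, Complex.cpow_neg]
    congr 2
    push_cast
    ring
  have e2 : ∑ j ∈ Finset.range k, ((a - 1 - ((k - 1 - j : ℕ) : ℝ) : ℝ) : ℂ) ^ (-s) =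
      ∑ i ∈ Finset.range k, 1 / ((i : ℂ) + ((a - k : ℝ) : ℂ)) ^ s := by
    refine Finset.sum_congr rfl fun m hm => ?_
    rw [one_div, Complex.cpow_neg]
    congr 2
    have hm' : m + 1 ≤ k := Finset.mem_range.mp hm
    have : k - 1 - m = k - (m + 1) := by omega
    rw [this, Nat.cast_sub hm']
    push_cast
    ring
  rw [e1, e2]
  exact h

/-- `ζ_H(·, a)` is holomorphic away from `s = 1`. -/
theorem differentiableAt_hurwitzZetaPos (a : ℝ) {s : ℂ} (hs : s ≠ 1) :
    DifferentiableAt ℂ (fun s => hurwitzZetaPos s a) s := by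
  unfold hurwitzZetaPos
  refine (HurwitzZeta.differentiableAt_hurwitzZeta _ hs).sub ?_
  refine DifferentiableAt.fun_sum fun m hm => ?_
  have hm' : m + 1 < ⌈a⌉₊ := by have := Finset.mem_range.mp hm; omega
  have h2 : ((m + 1 : ℕ) : ℝ) < a := Nat.lt_ceil.mp hm'
  push_cast at h2
  refine DifferentiableAt.const_cpow (differentiableAt_id.neg) (Or.inl ?_)
  rw [Complex.ofReal_ne_zero]
  linarith

/-- The general term `(n + x)^α [(n + x)^β + p]^{-s}` of the simple zeta function. -/
noncomputable def simpleZetaTerm (α β x p : ℝ) (s : ℂ) (n : ℕ) : ℂ :=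
  ((((n : ℝ) + x) ^ α : ℝ) : ℂ) * (((((n : ℝ) + x) ^ β + p : ℝ)) : ℂ) ^ (-s)

/-- The points `(1 + α)/β - j`, `j = 0, 1, 2, …`, that are not among `0, -1, -2, …`.
If `p = 0` only `j = 0` is kept. -/
def simpleZetaPoles (α β p : ℝ) : Set ℂ :=
  {s | ∃ j : ℕ, s = (((1 + α) / β - j : ℝ) : ℂ) ∧ (∀ m : ℕ, s ≠ -(m : ℂ)) ∧ (p ≠ 0 ∨ j = 0)}

/-- `Z` is the analytic continuation of the simple zeta function
`∑_{n ≥ 1} (n + x)^α [(n + x)^β + p]^{-s}`, `Re s > (1 + α)/β`, to the whole plane, regular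
outside `simpleZetaPoles α β p` and with a simple pole at each of these points. -/
structure IsSimpleZeta (α β x p : ℝ) (Z : ℂ → ℂ) : Prop where
  /-- `Z` is the sum of the series (indexed from `1`) in the half plane of convergence. -/
  hasSum : ∀ s : ℂ, (1 + α) / β < s.re →
    HasSum (fun n : ℕ => simpleZetaTerm α β x p s (n + 1)) (Z s)
  /-- `Z` is regular outside the poles. -/
  analyticAt : ∀ s : ℂ, s ∉ simpleZetaPoles α β p → AnalyticAt ℂ Z s
  /-- Each of the poles is a simple pole. -/
  simplePole : ∀ s ∈ simpleZetaPoles α β p, meromorphicOrderAt Z s = -1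

/-- The `n`-th factor
`(1 + p/(n+x)^β)^{(n+x)^α} exp((n+x)^α ∑_{j=1}^q ((-1)^j / j) p^j / (n+x)^{βj})`
of the regularized product of genus `q`. -/
noncomputable def simpleZetaFactor (α β x p : ℝ) (q n : ℕ) : ℝ :=
  (1 + p / ((n : ℝ) + x) ^ β) ^ (((n : ℝ) + x) ^ α) *
    Real.exp (((n : ℝ) + x) ^ α *
      ∑ j ∈ Finset.Icc 1 q, (-1 : ℝ) ^ j / j * (p ^ j / ((n : ℝ) + x) ^ (β * j)))

/-! Write `a = x + 1` and `u = p / (n + a)^β`. Each term of the series is `(n + a)^(α - β s) (1 +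
u)^(-s)`. Expanding `(1 + u)^(-s)` to `K` terms makes the `j`-th term sum to `binom(-s, j) p^j ζ_H(β
(s + j) - α, a)`, while the remainder is `O(|u|^K)` and sums to a holomorphic function on `Re s > (1
+ α)/β - K` (`norm_zetaRemTerm_le`). Letting `K` grow continues the function to the plane. Its only
possible poles come from the Hurwitz pole at `1`, and the zeros of `binom(-s, j)` cancel those at
nonpositive integers (`zetaResidue_eq_zero_iff`).

At `s = 0` take `K = q + 1`. The remainder vanishes there, and differentiating it term by term gives
`-log F_q` (`tprod_simpleZetaFactor`). For `j ≥ 1`, `binom(-s, j)` has a simple zero of slope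
`(-1)^j / j`, so a regular Hurwitz factor contributes only to the derivative. If `(1 + α)/β = q`,
the zero meets the pole for `j = q`: the value gains a term, and the derivative involves the
constant `-Ψ(a)` of the Laurent expansion and the second Taylor coefficient of `binom(-s, q)`, a
harmonic number (`hasDerivAt_zetaTerm_pole`). -/

open Filter Topology Set

/-! ### Binomial coefficients and the Taylor remainder of `(1 + u)^(-s)` -/

/-- The binomial coefficient `binom(-s, j)` as a function of the complex variable `s`. -/
noncomputable def negBinom (j : ℕ) (s : ℂ) : ℂ :=
  (∏ i ∈ Finset.range j, (-(s + i))) / (j.factorial : ℂ)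

@[simp] theorem negBinom_zero (s : ℂ) : negBinom 0 s = 1 := by simp [negBinom]

theorem differentiable_negBinom (j : ℕ) : Differentiable ℂ (negBinom j) := by
  unfold negBinom
  fun_prop

theorem negBinom_succ (j : ℕ) (s : ℂ) :
    negBinom (j + 1) s * (j + 1) = -s * negBinom j (s + 1) := by
  have h1 : (j.factorial : ℂ) ≠ 0 := by exact_mod_cast j.factorial_ne_zero
  have h2 : (j + 1 : ℂ) ≠ 0 := by exact_mod_cast j.succ_ne_zero
  simp only [negBinom, Finset.prod_range_succ', Nat.factorial_succ]
  push_cast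
  field_simp
  simp only [mul_comm, add_zero]
  refine congrArg (-(s * ·)) (Finset.prod_congr rfl fun i _ => ?_)
  ring

theorem negBinom_eq_zero_iff (j : ℕ) (s : ℂ) : negBinom j s = 0 ↔ ∃ i < j, s = -(i : ℂ) := by
  have h1 : (j.factorial : ℂ) ≠ 0 := by exact_mod_cast j.factorial_ne_zero
  simp [negBinom, Finset.prod_eq_zero_iff, h1, add_eq_zero_iff_eq_neg,
    neg_eq_iff_eq_neg]
  grind

/-- The remainder of the binomial expansion of `(1 + u)^{-s}` after `K` terms. -/
noncomputable def binomRem (K : ℕ) (s : ℂ) (u : ℝ) : ℂ :=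
  ((1 + u : ℝ) : ℂ) ^ (-s) - ∑ j ∈ Finset.range K, negBinom j s * (u : ℂ) ^ j

/-- Differentiation in `u` keeps the shape of the remainder, dropping one term and shifting `s`;
this drives the induction in `norm_binomRem_le`. -/
theorem hasDerivAt_binomRem (K : ℕ) (s : ℂ) {u : ℝ} (hu : -1 < u) :
    HasDerivAt (binomRem (K + 1) s) (-s * binomRem K (s + 1) u) u := by
  have hne : ((1 + u : ℝ) : ℂ) ∈ Complex.slitPlane := by
    rw [Complex.ofReal_mem_slitPlane]; linarith
  have h2 : HasDerivAt (fun z : ℂ => (1 + z) ^ (-s) -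
      ∑ j ∈ Finset.range (K + 1), negBinom j s * z ^ j) (-s * (1 + u : ℂ) ^ (-s - 1) * 1 -
      ∑ j ∈ Finset.range (K + 1), negBinom j s * (j * (u : ℂ) ^ (j - 1))) u := by
    refine (((hasDerivAt_id (u : ℂ)).const_add 1).cpow_const (by simpa using hne)).sub ?_
    refine HasDerivAt.fun_sum fun j _ => HasDerivAt.const_mul _ ?_
    exact hasDerivAt_pow j (u : ℂ)
  have h3 : binomRem (K + 1) s = fun u : ℝ => (1 + u : ℂ) ^ (-s) -
      ∑ j ∈ Finset.range (K + 1), negBinom j s * (u : ℂ) ^ j := by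
    funext u
    simp [binomRem]
  rw [h3]
  refine h2.comp_ofReal.congr_deriv ?_
  rw [Finset.sum_range_succ']
  simp only [binomRem, mul_one, Nat.cast_zero, zero_mul, mul_zero, add_zero, mul_sub,
    Finset.mul_sum]
  congr 1
  · rw [neg_add', Complex.ofReal_add, Complex.ofReal_one]
  · refine Finset.sum_congr rfl fun j _ => ?_
    have := negBinom_succ j s
    push_cast
    rw [← mul_assoc, this]
    simp [mul_assoc]

theorem binomRem_succ_zero (K : ℕ) (s : ℂ) : binomRem (K + 1) s 0 = 0 := by
  simp [binomRem, Finset.sum_range_succ']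

theorem differentiable_binomRem (K : ℕ) {u : ℝ} (hu : -1 < u) :
    Differentiable ℂ (fun s => binomRem K s u) := by
  unfold binomRem
  have h : ((1 + u : ℝ) : ℂ) ≠ 0 := by
    rw [Complex.ofReal_ne_zero]; linarith
  refine Differentiable.sub (fun s => ?_) (Differentiable.fun_sum fun j _ =>
    (differentiable_negBinom j).mul_const _)
  exact DifferentiableAt.const_cpow (differentiableAt_id.neg) (Or.inl h)

theorem lt_of_mem_uIcc_zero {u₀ u : ℝ} (h : -1 < u₀) (hu : u ∈ uIcc 0 u₀) : -1 < u := by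
  rcases Set.mem_uIcc.1 hu with h | h <;> linarith [h.1]

/-- Taylor's estimate for the binomial series, uniform for `s` in a disc and `u` in a segment. -/
theorem norm_binomRem_le {u₀ : ℝ} (h₀ : -1 < u₀) (K : ℕ) : ∀ M : ℝ, ∃ C : ℝ, 0 ≤ C ∧
    ∀ s : ℂ, ‖s‖ ≤ M → ∀ u ∈ uIcc 0 u₀, ‖binomRem K s u‖ ≤ C * |u| ^ K := by
  induction K with
  | zero =>
    intro M
    have hc : ContinuousOn (fun u : ℝ => |Real.log (1 + u)|) (uIcc 0 u₀) := by
      refine ContinuousOn.abs (ContinuousOn.log (by fun_prop) fun u hu => ?_)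
      linarith [lt_of_mem_uIcc_zero h₀ hu]
    obtain ⟨B, hB⟩ := isCompact_uIcc.bddAbove_image hc
    refine ⟨Real.exp (B * M), (Real.exp_pos _).le, fun s hs u hu => ?_⟩
    have hpos : 0 < 1 + u := by linarith [lt_of_mem_uIcc_zero h₀ hu]
    have hb : |Real.log (1 + u)| ≤ B := hB (mem_image_of_mem _ hu)
    simp only [binomRem, Finset.range_zero, Finset.sum_empty, sub_zero, pow_zero, mul_one]
    rw [Complex.norm_cpow_eq_rpow_re_of_pos hpos, Real.rpow_def_of_pos hpos]
    refine Real.exp_le_exp.2 ((le_abs_self _).trans ?_)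
    rw [abs_mul]
    refine mul_le_mul hb ?_ (abs_nonneg _) ((abs_nonneg _).trans hb)
    rw [Complex.neg_re, abs_neg]
    exact (Complex.abs_re_le_norm s).trans hs
  | succ K ih =>
    intro M
    -- The derivative involves `s + 1`, hence the larger disc. The mean value inequality from `0`,
    -- where the remainder vanishes, supplies one more factor `|u|`.
    obtain ⟨C, hC, h⟩ := ih (M + 1)
    refine ⟨|M| * C, by positivity, fun s hs u hu => ?_⟩
    have hsub : uIcc 0 u ⊆ uIcc 0 u₀ := uIcc_subset_uIcc left_mem_uIcc hu
    have key := (convex_uIcc 0 u).norm_image_sub_le_of_norm_hasDerivWithin_le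
      (f := binomRem (K + 1) s) (C := |M| * (C * |u| ^ K))
      (fun v hv => (hasDerivAt_binomRem K s
        (lt_of_mem_uIcc_zero h₀ (hsub hv))).hasDerivWithinAt)
      (fun v hv => by
        rw [norm_mul, norm_neg]
        refine mul_le_mul (hs.trans (le_abs_self _)) ?_ (norm_nonneg _) (abs_nonneg _)
        refine (h (s + 1) ?_ v (hsub hv)).trans ?_
        · exact (norm_add_le _ _).trans (by simpa using hs)
        · refine mul_le_mul_of_nonneg_left (pow_le_pow_left₀ (abs_nonneg _) ?_ _) hC
          simpa using abs_sub_left_of_mem_uIcc hv)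
      left_mem_uIcc right_mem_uIcc
    rw [binomRem_succ_zero, sub_zero, sub_zero, Real.norm_eq_abs] at key
    calc _ ≤ _ := key
      _ = _ := by ring

/-! ### The remainder series and its half plane of convergence -/

/-- The general term `(n + a)^{α - β s} ((1 + u)^{-s} - ∑_{j < K} binom(-s, j) u^j)`,
`u = p / (n + a)^β`, of the remainder in the expansion of the simple zeta function. -/
noncomputable def zetaRemTerm (α β a p : ℝ) (K : ℕ) (n : ℕ) (s : ℂ) : ℂ :=
  ((n + a : ℝ) : ℂ) ^ ((α : ℂ) - β * s) * binomRem K s (p / (n + a) ^ β)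

/-- The remainder after `K` terms in the expansion of the simple zeta function. -/
noncomputable def zetaRem (α β a p : ℝ) (K : ℕ) (s : ℂ) : ℂ :=
  ∑' n, zetaRemTerm α β a p K n s

section
variable {α β a p : ℝ}

/-- Since `|u|` is largest at `n = 0`, a single compact segment serves all `n`, and it avoids `-1`
as soon as its endpoint exceeds `-1`. -/
theorem div_rpow_mem_uIcc (hβ : 0 < β) (ha : 0 < a) (p : ℝ) (n : ℕ) :
    p / (n + a) ^ β ∈ uIcc 0 (p / a ^ β) := by
  have h1 : 0 < a ^ β := Real.rpow_pos_of_pos ha _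
  have h2 : a ^ β ≤ (n + a) ^ β :=
    Real.rpow_le_rpow ha.le (by have := n.cast_nonneg (α := ℝ); linarith) hβ.le
  have h3 : 0 < ((n : ℝ) + a) ^ β := h1.trans_le h2
  rw [Set.mem_uIcc]
  rcases le_total 0 p with hp | hp
  · exact Or.inl ⟨by positivity, by gcongr⟩
  · refine Or.inr ⟨?_, div_nonpos_of_nonpos_of_nonneg hp h3.le⟩
    rw [div_le_div_iff₀ h1 h3]
    exact mul_le_mul_of_nonpos_left h2 hp

theorem neg_one_lt_div_rpow (ha : 0 < a) (hp : 0 < a ^ β + p) : -1 < p / a ^ β := by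
  rw [lt_div_iff₀ (Real.rpow_pos_of_pos ha _)]
  linarith

theorem neg_one_lt_div_add_rpow (hβ : 0 < β) (ha : 0 < a) (hp : 0 < a ^ β + p) (n : ℕ) :
    -1 < p / (n + a) ^ β :=
  lt_of_mem_uIcc_zero (neg_one_lt_div_rpow ha hp) (div_rpow_mem_uIcc hβ ha p n)

theorem natCast_add_pos (ha : 0 < a) (n : ℕ) : 0 < (n : ℝ) + a := by positivity

theorem differentiable_zetaRemTerm (hβ : 0 < β) (ha : 0 < a) (hp : 0 < a ^ β + p) (K n : ℕ) :
    Differentiable ℂ (zetaRemTerm α β a p K n) := by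
  refine Differentiable.mul (fun s => ?_)
    (differentiable_binomRem K (neg_one_lt_div_add_rpow hβ ha hp n))
  refine DifferentiableAt.const_cpow (by fun_prop) (Or.inl ?_)
  exact_mod_cast (natCast_add_pos ha n).ne'

theorem summable_natCast_add_rpow (ha : 0 < a) {e : ℝ} (he : e < -1) :
    Summable fun n : ℕ => ((n : ℝ) + a) ^ e := by
  refine ((Real.summable_one_div_nat_add_rpow a (-e)).2 (by linarith)).congr fun n => ?_
  have hb := natCast_add_pos ha n
  rw [abs_of_pos hb, Real.rpow_neg hb.le, one_div, inv_inv]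

/-- The base may be less than `1`, so monotonicity in the exponent is applied to `b / a ≥ 1`; the
bound on `|e|` keeps the constant uniform in `s`. -/
theorem rpow_le_const_mul_rpow (ha : 0 < a) {b e e₀ B : ℝ} (hb : a ≤ b) (he : e ≤ e₀)
    (hB : |e| ≤ B) :
    b ^ e ≤ Real.exp (|Real.log a| * B) * a ^ (-e₀) * b ^ e₀ := by
  have hb0 : 0 < b := ha.trans_le hb
  have h1 : (b / a) ^ e ≤ (b / a) ^ e₀ := Real.rpow_le_rpow_of_exponent_le ((one_le_div ha).2 hb) he
  rw [Real.div_rpow hb0.le ha.le, Real.div_rpow hb0.le ha.le, div_le_iff₀ (by positivity)] at h1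
  have h2 : a ^ e ≤ Real.exp (|Real.log a| * B) := by
    rw [Real.rpow_def_of_pos ha]
    refine Real.exp_le_exp.2 ((le_abs_self _).trans ?_)
    rw [abs_mul]
    exact mul_le_mul_of_nonneg_left hB (abs_nonneg _)
  calc b ^ e ≤ _ := h1
    _ ≤ b ^ e₀ / a ^ e₀ * Real.exp (|Real.log a| * B) := by gcongr
    _ = _ := by rw [Real.rpow_neg ha.le]; ring

/-- The factor `|u|^K` lowers the exponent of `n + a` to at most `α - β σ - β K`, which is below
`-1` exactly under the assumption on `σ`. -/
theorem norm_zetaRemTerm_le (hβ : 0 < β) (ha : 0 < a) (hp : 0 < a ^ β + p) (K : ℕ)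
    {σ : ℝ} (hσ : (1 + α) / β - K < σ) (M : ℝ) :
    ∃ u : ℕ → ℝ, Summable u ∧ ∀ n, ∀ s : ℂ, σ ≤ s.re → ‖s‖ ≤ M →
      ‖zetaRemTerm α β a p K n s‖ ≤ u n := by
  obtain ⟨C, hC, h⟩ := norm_binomRem_le (neg_one_lt_div_rpow ha hp) K M
  let B := |α| + β * M + β * K
  have he₀ : α - β * σ - β * K < -1 := by
    rw [sub_lt_iff_lt_add, div_lt_iff₀ hβ] at hσ
    linarith
  refine ⟨fun n => C * |p| ^ K * (Real.exp (|Real.log a| * B) * a ^ (-(α - β * σ - β * K)) *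
    (n + a) ^ (α - β * σ - β * K)), ((summable_natCast_add_rpow ha he₀).mul_left _).mul_left _,
    fun n s hs hM => ?_⟩
  have hb := natCast_add_pos ha n
  have hb' : a ≤ n + a := by have := n.cast_nonneg (α := ℝ); linarith
  have hre : |s.re| ≤ M := (Complex.abs_re_le_norm s).trans hM
  have h1 := rpow_le_const_mul_rpow ha (e := α - β * s.re - β * K) (e₀ := α - β * σ - β * K)
    (B := B) hb' (by gcongr) (by
      refine (abs_sub _ _).trans ?_
      rw [abs_of_nonneg (by positivity : 0 ≤ β * K)]
      refine add_le_add_left ((abs_sub _ _).trans ?_) _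
      rw [abs_mul, abs_of_pos hβ]
      gcongr)
  rw [zetaRemTerm, norm_mul, Complex.norm_cpow_eq_rpow_re_of_pos hb]
  have h2 : |p / (n + a) ^ β| ^ K = |p| ^ K * (n + a) ^ (-(β * K)) := by
    rw [abs_div, abs_of_pos (Real.rpow_pos_of_pos hb _), div_pow, ← Real.rpow_natCast (_ ^ β),
      ← Real.rpow_mul hb.le, Real.rpow_neg hb.le, div_eq_mul_inv]
  have h3 : ((α : ℂ) - β * s).re = α - β * s.re := by simp
  rw [h3]
  calc _ ≤ ((n : ℝ) + a) ^ (α - β * s.re) * (C * |p / (n + a) ^ β| ^ K) := by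
        gcongr
        exact h s hM _ (div_rpow_mem_uIcc hβ ha p n)
    _ = C * |p| ^ K * (n + a) ^ (α - β * s.re - β * K) := by
        rw [h2, sub_eq_add_neg _ (β * (K : ℝ)), Real.rpow_add hb]
        ring
    _ ≤ _ := mul_le_mul_of_nonneg_left h1 (by positivity)

/-- Near each point of the half plane `Re s > (1 + α)/β - K` the series of the remainder is
dominated by a convergent series. -/
theorem exists_nhds_zetaRemTerm_bound (hβ : 0 < β) (ha : 0 < a) (hp : 0 < a ^ β + p) (K : ℕ)
    {s : ℂ} (hs : (1 + α) / β - K < s.re) :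
    ∃ U : Set ℂ, IsOpen U ∧ s ∈ U ∧ ∃ u : ℕ → ℝ, Summable u ∧ ∀ n, ∀ w ∈ U,
      ‖zetaRemTerm α β a p K n w‖ ≤ u n := by
  obtain ⟨σ, h1, h2⟩ := exists_between hs
  obtain ⟨u, hu, hb⟩ := norm_zetaRemTerm_le hβ ha hp K h1 (‖s‖ + 1)
  refine ⟨{w | σ < w.re} ∩ {w | ‖w‖ < ‖s‖ + 1}, ?_, ⟨h2, by simp⟩, u, hu,
    fun n w hw => hb n w hw.1.le hw.2.le⟩
  exact (isOpen_lt continuous_const Complex.continuous_re).inter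
    (isOpen_lt continuous_norm continuous_const)

theorem summable_zetaRemTerm (hβ : 0 < β) (ha : 0 < a) (hp : 0 < a ^ β + p) (K : ℕ)
    {s : ℂ} (hs : (1 + α) / β - K < s.re) : Summable fun n => zetaRemTerm α β a p K n s := by
  obtain ⟨U, -, hsU, u, hu, hb⟩ := exists_nhds_zetaRemTerm_bound hβ ha hp K hs
  exact hu.of_norm_bounded fun n => hb n s hsU

theorem differentiableAt_zetaRem (hβ : 0 < β) (ha : 0 < a) (hp : 0 < a ^ β + p) (K : ℕ)
    {s : ℂ} (hs : (1 + α) / β - K < s.re) : DifferentiableAt ℂ (zetaRem α β a p K) s := by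
  obtain ⟨U, hU, hsU, u, hu, hb⟩ := exists_nhds_zetaRemTerm_bound hβ ha hp K hs
  exact (Complex.differentiableOn_tsum_of_summable_norm hu
    (fun n => (differentiable_zetaRemTerm hβ ha hp K n).differentiableOn) hU hb).differentiableAt
    (hU.mem_nhds hsU)

theorem hasSum_deriv_zetaRem (hβ : 0 < β) (ha : 0 < a) (hp : 0 < a ^ β + p) (K : ℕ)
    {s : ℂ} (hs : (1 + α) / β - K < s.re) :
    HasSum (fun n => deriv (zetaRemTerm α β a p K n) s) (deriv (zetaRem α β a p K) s) := by
  obtain ⟨U, hU, hsU, u, hu, hb⟩ := exists_nhds_zetaRemTerm_bound hβ ha hp K hs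
  exact Complex.hasSum_deriv_of_summable_norm hu
    (fun n => (differentiable_zetaRemTerm hβ ha hp K n).differentiableOn) hU hb hsU

theorem zetaRemTerm_eq_succ_add (ha : 0 < a) (K n : ℕ) (s : ℂ) :
    zetaRemTerm α β a p K n s = zetaRemTerm α β a p (K + 1) n s +
      p ^ K * negBinom K s * ((n + a : ℝ) : ℂ) ^ (-(β * (s + K) - α)) := by
  have hb := natCast_add_pos ha n
  have hb' : ((n + a : ℝ) : ℂ) ≠ 0 := by exact_mod_cast hb.ne'
  have h1 : (((p / (n + a) ^ β : ℝ) : ℂ)) ^ K = p ^ K * ((n + a : ℝ) : ℂ) ^ (-(β * K : ℂ)) := by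
    rw [Complex.ofReal_div, div_pow, Complex.ofReal_cpow hb.le, ← Complex.cpow_nat_mul,
      Complex.cpow_neg, div_eq_mul_inv, mul_comm (K : ℂ)]
  have h2 : (-(β * (s + K) - α) : ℂ) = (α - β * s) + (-(β * K)) := by ring
  rw [h2, Complex.cpow_add _ _ hb']
  simp only [zetaRemTerm, binomRem, Finset.sum_range_succ, h1]
  ring

/-- In this half plane the split-off Hurwitz series still converges, so the sum can be split. The
identity glues the continuations for successive `K`. -/
theorem zetaRem_eq_succ_add (hβ : 0 < β) (ha : 0 < a) (hp : 0 < a ^ β + p) (K : ℕ)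
    {s : ℂ} (hs : (1 + α) / β - K < s.re) :
    zetaRem α β a p K s = zetaRem α β a p (K + 1) s +
      p ^ K * negBinom K s * hurwitzZetaPos (β * (s + K) - α) a := by
  have h1 : (1 : ℝ) < ((β : ℂ) * (s + K) - α).re := by
    rw [sub_lt_iff_lt_add, div_lt_iff₀ hβ] at hs
    simp
    linarith
  have h2 := (summable_zetaRemTerm hβ ha hp (K + 1) (s := s) (by push_cast; linarith)).hasSum
  have h3 := h2.add ((hasSum_hurwitzZetaPos ha h1).mul_left (p ^ K * negBinom K s))
  simp only [← zetaRemTerm_eq_succ_add ha] at h3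
  exact h3.tsum_eq
end

/-! ### The digamma function and the Laurent constant of the Hurwitz zeta function -/

theorem Complex.digamma_ofReal {y : ℝ} (hy : 0 < y) :
    Complex.digamma y = (deriv (Real.log ∘ Real.Gamma) y : ℝ) := by
  have hm (m : ℕ) : y ≠ -m := by
    have := m.cast_nonneg (α := ℝ)
    linarith
  have h1 := (Real.differentiableAt_Gamma hm).hasDerivAt
  have h2 : HasDerivAt (fun t : ℝ => Complex.Gamma t) (deriv Complex.Gamma y) y :=
    (Complex.differentiableAt_Gamma (y : ℂ) fun m => by exact_mod_cast hm m).hasDerivAt.comp_ofReal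
  have h3 := h1.ofReal_comp
  simp only [← Complex.Gamma_ofReal] at h3
  have h4 := (h1.log (Real.Gamma_pos_of_pos hy).ne').deriv
  rw [Complex.digamma_def, logDeriv_apply, h2.unique h3, Complex.Gamma_ofReal, Function.comp_def,
    h4, Complex.ofReal_div]

/-- By convexity of `log Γ` the derivative lies between the slopes over the two adjacent unit
intervals, and the functional equation evaluates these slopes. -/
theorem Real.deriv_log_comp_Gamma_mem_Icc {y : ℝ} (hy : 0 < y) :
    deriv (Real.log ∘ Real.Gamma) (y + 1) ∈ Icc (Real.log y) (Real.log (y + 1)) := by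
  have h_rec {x : ℝ} (hx : 0 < x) :
      (Real.log ∘ Real.Gamma) (x + 1) = (Real.log ∘ Real.Gamma) x + Real.log x := by
    simp only [Function.comp_apply, Real.Gamma_add_one hx.ne',
      Real.log_mul hx.ne' (Real.Gamma_pos_of_pos hx).ne', add_comm]
  have hy1 : 0 < y + 1 := by linarith
  have hder : DifferentiableAt ℝ (Real.log ∘ Real.Gamma) (y + 1) := by
    refine (Real.differentiableAt_Gamma fun m => ?_).log (Real.Gamma_pos_of_pos hy1).ne'
    have := m.cast_nonneg (α := ℝ)
    linarith
  constructor
  · refine (le_of_eq ?_).trans <| Real.convexOn_log_Gamma.slope_le_deriv (mem_Ioi.2 hy)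
      (mem_Ioi.2 hy1) (by linarith) hder
    rw [slope_def_field, h_rec hy]
    ring
  · refine (Real.convexOn_log_Gamma.deriv_le_slope (mem_Ioi.2 hy1)
      (mem_Ioi.2 (by linarith : 0 < y + 1 + 1)) (by linarith) hder).trans (le_of_eq ?_)
    rw [slope_def_field, h_rec hy1]
    ring

theorem Complex.digamma_add_natCast {a : ℝ} (ha : 0 < a) (N : ℕ) :
    Complex.digamma (a + N) = Complex.digamma a + ∑ n ∈ Finset.range N, ((n : ℂ) + a)⁻¹ := by
  induction N with
  | zero => simp
  | succ N ih =>
    rw [Finset.sum_range_succ, ← add_assoc, ← ih, Nat.cast_succ, ← add_assoc,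
      Complex.digamma_apply_add_one, add_comm (N : ℂ)]
    intro m h
    have h' : (a + N : ℝ) = -m := by exact_mod_cast h
    have := m.cast_nonneg (α := ℝ)
    have := N.cast_nonneg (α := ℝ)
    linarith

theorem tendsto_deriv_log_Gamma_sub_log {a : ℝ} (ha : 0 < a) :
    Tendsto (fun N : ℕ => deriv (Real.log ∘ Real.Gamma) (a + N) - Real.log N) atTop (𝓝 0) := by
  have h1 (y : ℝ) : Tendsto (fun N : ℕ => Real.log (N + y) - Real.log N) atTop (𝓝 0) :=
    (Real.tendsto_log_comp_add_sub_log y).comp tendsto_natCast_atTop_atTop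
  refine tendsto_of_tendsto_of_tendsto_of_le_of_le' (h1 (a - 1)) (h1 a) ?_ ?_ <;>
  · filter_upwards [eventually_ge_atTop 1] with N hN
    have hN' : (1 : ℝ) ≤ N := by exact_mod_cast hN
    have h := Real.deriv_log_comp_Gamma_mem_Icc (y := N + (a - 1)) (by linarith)
    rw [show (N : ℝ) + (a - 1) + 1 = a + N by ring] at h
    first
    | linarith [h.1]
    | rw [add_comm (N : ℝ)]; linarith [h.2]

/-- `∑_{n < N} (1/(n+a) - 1/(n+1)) → -Ψ(a) - γ`. -/
theorem tendsto_sum_inv_sub_inv {a : ℝ} (ha : 0 < a) :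
    Tendsto (fun N : ℕ => ∑ n ∈ Finset.range N, (((n : ℂ) + a)⁻¹ - ((n : ℂ) + 1)⁻¹)) atTop
      (𝓝 (-Complex.digamma a - Real.eulerMascheroniConstant)) := by
  have h := (Complex.continuous_ofReal.tendsto _).comp ((tendsto_deriv_log_Gamma_sub_log ha).sub
    Real.tendsto_harmonic_sub_log)
  have h2 := h.sub_const (Complex.digamma a)
  rw [show (((0 - Real.eulerMascheroniConstant : ℝ)) : ℂ) - Complex.digamma a =
    -Complex.digamma a - Real.eulerMascheroniConstant by push_cast; ring] at h2
  refine h2.congr fun N => ?_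
  have h3 : 0 < a + N := by positivity
  have h4 := Complex.digamma_add_natCast ha N
  rw [← Complex.ofReal_natCast, ← Complex.ofReal_add, Complex.digamma_ofReal h3] at h4
  have h5 : ((harmonic N : ℝ) : ℂ) = ∑ n ∈ Finset.range N, ((n : ℂ) + 1)⁻¹ := by
    simp [harmonic]
  simp only [Function.comp_apply, Complex.ofReal_sub, h4, h5, Finset.sum_sub_distrib]
  ring

theorem zetaRemTerm_zero {α β a p : ℝ} (ha : 0 < a) {n : ℕ} (hp : 0 < (n + a) ^ β + p) (s : ℂ) :
    zetaRemTerm α β a p 0 n s =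
      ((((n : ℝ) + a) ^ α : ℝ) : ℂ) * ((((n : ℝ) + a) ^ β + p : ℝ) : ℂ) ^ (-s) := by
  have hb := natCast_add_pos ha n
  have hb' : ((n + a : ℝ) : ℂ) ≠ 0 := by exact_mod_cast hb.ne'
  have hbβ := Real.rpow_pos_of_pos hb β
  have h1 : ((n + a) ^ β + p : ℝ) = (n + a) ^ β * (1 + p / (n + a) ^ β) := by
    field_simp
  have h2 : 0 < 1 + p / (n + a) ^ β := by
    rw [h1] at hp
    exact pos_of_mul_pos_right hp hbβ.le
  have h3 : (-(β * s) : ℂ) = β * -s := by ring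
  rw [h1, Complex.ofReal_mul, Complex.mul_cpow_ofReal_nonneg hbβ.le h2.le, zetaRemTerm, binomRem,
    sub_eq_add_neg, Complex.cpow_add _ _ hb', Complex.ofReal_cpow hb.le, Complex.ofReal_cpow hb.le,
    h3, Complex.cpow_mul_ofReal_nonneg hb.le, ← Complex.ofReal_cpow hb.le]
  simp [mul_assoc, Complex.ofReal_cpow hb.le]

/-- With base `n + 1` and `p = a - 1` one has `(n + 1)(1 + u) = n + a`, so the remainder terms at `s
= 1` are `1/(n + a) - 1/(n + 1)`. -/
theorem zetaRem_one_apply_one {a : ℝ} (ha : 0 < a) :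
    zetaRem 0 1 1 (a - 1) 1 1 = -Complex.digamma a - Real.eulerMascheroniConstant := by
  have h1 := (summable_zetaRemTerm (α := 0) (β := 1) (a := 1) (p := a - 1) one_pos one_pos
    (by simpa using ha) 1 (s := 1) (by simp)).hasSum.tendsto_sum_nat
  refine tendsto_nhds_unique h1 ((tendsto_sum_inv_sub_inv ha).congr fun N =>
    Finset.sum_congr rfl fun n _ => ?_)
  have h2 : ((n : ℂ) + 1) ≠ 0 := by exact_mod_cast n.succ_ne_zero
  have h3 : ((n : ℂ) + a) ≠ 0 := by exact_mod_cast (natCast_add_pos ha n).ne'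
  have h4 : (1 : ℂ) + (a - 1) / (n + 1) = (n + a) / (n + 1) := by field_simp; ring
  simp only [zetaRemTerm, binomRem]
  simp [h4, Complex.cpow_neg_one]
  field_simp

/-- The Laurent expansion of the Hurwitz zeta function at `s = 1`. -/
theorem exists_hurwitzZetaPos_eq {a : ℝ} (ha : 0 < a) :
    ∃ h : ℂ → ℂ, Differentiable ℂ h ∧ h 1 = -Complex.digamma a ∧
      ∀ s ≠ 1, hurwitzZetaPos s a = (s - 1)⁻¹ + h s := by
  have hd : Differentiable ℂ fun s => hurwitzZetaPos s a - riemannZeta s := by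
    have h1 := HurwitzZeta.differentiable_hurwitzZeta_sub_hurwitzZeta a 0
    simp only [HurwitzZeta.hurwitzZeta_zero] at h1
    have h2 : Differentiable ℂ fun s : ℂ =>
        ∑ m ∈ Finset.range (⌈a⌉₊ - 1), ((a - 1 - m : ℝ) : ℂ) ^ (-s) := by
      refine Differentiable.fun_sum fun m hm s => ?_
      have hm' : m + 1 < ⌈a⌉₊ := by have := Finset.mem_range.mp hm; omega
      have h2 : ((m + 1 : ℕ) : ℝ) < a := Nat.lt_ceil.mp hm'
      push_cast at h2
      refine DifferentiableAt.const_cpow differentiableAt_id.neg (Or.inl ?_)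
      rw [Complex.ofReal_ne_zero]
      linarith
    have h3 : (fun s => hurwitzZetaPos s a - riemannZeta s) = fun s =>
        (HurwitzZeta.hurwitzZeta a s - riemannZeta s) -
          ∑ m ∈ Finset.range (⌈a⌉₊ - 1), ((a - 1 - m : ℝ) : ℂ) ^ (-s) := by
      funext s
      rw [hurwitzZetaPos]
      ring
    rw [h3]
    exact h1.sub h2
  refine ⟨fun s => riemannZeta₀ s + (hurwitzZetaPos s a - riemannZeta s),
    differentiable_riemannZeta₀.add hd, ?_, fun s hs => ?_⟩
  -- For `t > 1` the remainder series is `ζ_H(t, a) - ζ(t)`; both sides are continuous at `1`, so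
  -- the identity persists there. The constant `γ` of `riemannZeta₀` then cancels.
  · suffices h : hurwitzZetaPos 1 a - riemannZeta 1 = zetaRem 0 1 1 (a - 1) 1 1 by
      simp only [h, zetaRem_one_apply_one ha, riemannZeta₀_one]
      ring
    have hp : (0 : ℝ) < 1 ^ (1 : ℝ) + (a - 1) := by simpa using ha
    have hc := (differentiableAt_zetaRem (α := 0) (β := 1) one_pos one_pos hp 1
      (s := 1) (by simp)).continuousAt
    have hlim : Tendsto (fun t : ℝ => (t : ℂ)) (𝓝[>] 1) (𝓝 1) :=
      ((Complex.continuous_ofReal.tendsto 1).mono_left nhdsWithin_le_nhds)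
    refine tendsto_nhds_unique ((hd 1).continuousAt.tendsto.comp hlim)
      ((hc.tendsto.comp hlim).congr' ?_)
    filter_upwards [self_mem_nhdsWithin] with t (ht : 1 < t)
    have ht' : 1 < (t : ℂ).re := by simpa using ht
    have h0 := zetaRem_eq_succ_add (α := 0) (β := 1) one_pos one_pos hp 0 (s := t) (by simpa using ht)
    have h1 : zetaRem 0 1 1 (a - 1) 0 t = hurwitzZetaPos t a := by
      rw [← (hasSum_hurwitzZetaPos ha ht').tsum_eq]
      refine tsum_congr fun n => ?_
      rw [zetaRemTerm_zero one_pos (by simpa using natCast_add_pos ha n)]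
      simp
    have h2 : hurwitzZetaPos t 1 = riemannZeta t := by
      rw [← HurwitzZeta.hurwitzZeta_zero, ← AddCircle.coe_period]
      simp [hurwitzZetaPos]
    simp at h0
    simp [← h2, ← h1, h0]
  · change _ = (s - 1)⁻¹ + (riemannZeta₀ s + (hurwitzZetaPos s a - riemannZeta s))
    rw [riemannZeta_eq_inv_sub_add hs]
    ring

/-- The entire function `ζ_H(s, a) - 1/(s - 1)`. -/
noncomputable def hurwitzZetaReg (a : ℝ) (s : ℂ) : ℂ :=
  if s = 1 then -Complex.digamma a else hurwitzZetaPos s a - (s - 1)⁻¹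

theorem differentiable_hurwitzZetaReg {a : ℝ} (ha : 0 < a) :
    Differentiable ℂ (hurwitzZetaReg a) := by
  obtain ⟨h, hd, h1, h2⟩ := exists_hurwitzZetaPos_eq ha
  convert! hd
  funext s
  by_cases hs : s = 1
  · simp [hurwitzZetaReg, hs, h1]
  · simp [hurwitzZetaReg, hs, h2 s hs]

/-! ### The continuation, its poles and its uniqueness -/

section
variable {α β a p : ℝ}

/-- The point `(1 + α)/β - j`. -/
noncomputable def zetaPole (α β : ℝ) (j : ℕ) : ℂ := (((1 + α) / β - j : ℝ) : ℂ)

/-- The residue of `binom(-s, j) p^j ζ_H(β (s + j) - α, a)` at `(1 + α)/β - j`. -/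
noncomputable def zetaResidue (α β p : ℝ) (j : ℕ) : ℂ :=
  p ^ j * (β : ℂ)⁻¹ * negBinom j (zetaPole α β j)

/-- The regular part of `binom(-s, j) p^j ζ_H(β (s + j) - α, a)`. -/
noncomputable def zetaTermReg (α β a p : ℝ) (j : ℕ) (s : ℂ) : ℂ :=
  p ^ j * (negBinom j s * hurwitzZetaReg a (β * (s + j) - α) +
    (β : ℂ)⁻¹ * dslope (negBinom j) (zetaPole α β j) s)

/-- The continuation of `binom(-s, j) p^j ζ_H(β (s + j) - α, a)`, including the value at a
removable singularity. -/
noncomputable def zetaTerm (α β a p : ℝ) (j : ℕ) (s : ℂ) : ℂ :=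
  zetaTermReg α β a p j s + zetaResidue α β p j * (s - zetaPole α β j)⁻¹

/-- The continuation to the half plane `Re s > (1 + α)/β - K`. -/
noncomputable def zetaPartial (α β a p : ℝ) (K : ℕ) (s : ℂ) : ℂ :=
  zetaRem α β a p K s + ∑ j ∈ Finset.range K, zetaTerm α β a p j s

/-- The analytic continuation of `∑_{n ≥ 0} (n + a)^α [(n + a)^β + p]^{-s}`. -/
noncomputable def simpleZeta (α β a p : ℝ) (s : ℂ) : ℂ :=
  zetaPartial α β a p (⌊(1 + α) / β - s.re⌋₊ + 1) s

theorem zetaPole_injective (α β : ℝ) : Function.Injective (zetaPole α β) := by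
  intro i j h
  simpa [zetaPole] using h

theorem differentiable_dslope {f : ℂ → ℂ} (hf : Differentiable ℂ f) (c : ℂ) :
    Differentiable ℂ (dslope f c) := by
  rw [← differentiableOn_univ, Complex.differentiableOn_dslope univ_mem]
  exact hf.differentiableOn

theorem differentiable_zetaTermReg (α β p : ℝ) (ha : 0 < a) (j : ℕ) :
    Differentiable ℂ (zetaTermReg α β a p j) := by
  refine Differentiable.const_mul (Differentiable.add (Differentiable.mul
    (differentiable_negBinom j) ?_)
    ((differentiable_dslope (differentiable_negBinom j) _).const_mul _)) _
  exact (differentiable_hurwitzZetaReg ha).comp (by fun_prop)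

theorem mul_sub_zetaPole (hβ : β ≠ 0) (j : ℕ) (s : ℂ) :
    (β * (s + j) - α : ℂ) - 1 = β * (s - zetaPole α β j) := by
  have : (β : ℂ) ≠ 0 := by exact_mod_cast hβ
  simp only [zetaPole]
  push_cast
  field_simp
  ring

/-- With `c` the pole, the polar part `binom(-s, j) / (β (s - c))` splits into its residue term plus
`β⁻¹` times the difference quotient of `binom(-s, j)` at `c`. -/
theorem zetaTerm_eq (hβ : β ≠ 0) {j : ℕ} {s : ℂ} (hs : s ≠ zetaPole α β j) :
    zetaTerm α β a p j s = p ^ j * negBinom j s * hurwitzZetaPos (β * (s + j) - α) a := by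
  have hβ' : (β : ℂ) ≠ 0 := by exact_mod_cast hβ
  have h1 : s - zetaPole α β j ≠ 0 := sub_ne_zero.2 hs
  have h2 : (β * (s + j) - α : ℂ) ≠ 1 := by
    rw [← sub_ne_zero, mul_sub_zetaPole hβ]
    exact mul_ne_zero hβ' h1
  rw [zetaTerm, zetaTermReg, hurwitzZetaReg, if_neg h2, mul_sub_zetaPole hβ, dslope_of_ne _ hs,
    slope_def_field, zetaResidue]
  field_simp
  ring

/-- The zeros of `binom(-s, j)` are `0, …, -(j - 1)`. If `(1 + α)/β - j = -m`, then `m < j` because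
`(1 + α)/β > 0`, so every such candidate is cancelled. -/
theorem zetaResidue_eq_zero_iff (hβ : 0 < β) (hα : 0 ≤ α) (j : ℕ) :
    zetaResidue α β p j = 0 ↔ zetaPole α β j ∉ simpleZetaPoles α β p := by
  have hβ' : (β : ℂ) ≠ 0 := by exact_mod_cast hβ.ne'
  have hl : 0 < (1 + α) / β := by positivity
  have h1 : zetaPole α β j ∈ simpleZetaPoles α β p ↔
      (∀ m : ℕ, zetaPole α β j ≠ -(m : ℂ)) ∧ (p ≠ 0 ∨ j = 0) := by
    constructor
    · rintro ⟨i, hi, h⟩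
      have hij : j = i := zetaPole_injective α β hi
      subst hij
      exact h
    · exact fun h => ⟨j, rfl, h⟩
  have h2 : negBinom j (zetaPole α β j) = 0 ↔ ∃ m : ℕ, zetaPole α β j = -(m : ℂ) := by
    rw [negBinom_eq_zero_iff]
    refine ⟨fun ⟨m, _, h⟩ => ⟨m, h⟩, fun ⟨m, h⟩ => ⟨m, ?_, h⟩⟩
    have h' : (1 + α) / β - j = -(m : ℝ) := by
      rw [zetaPole] at h
      exact_mod_cast h
    have : (m : ℝ) < j := by linarith
    exact_mod_cast this
  rw [h1, zetaResidue, mul_eq_zero, mul_eq_zero, h2, pow_eq_zero_iff', inv_eq_zero]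
  simp only [hβ', or_false, Complex.ofReal_eq_zero]
  by_cases hp : p = 0 <;> by_cases hj : j = 0 <;> simp [hp, hj]

theorem mem_simpleZetaPoles_iff_exists (hβ : 0 < β) (hα : 0 ≤ α) (s : ℂ) :
    s ∈ simpleZetaPoles α β p ↔ ∃ j, s = zetaPole α β j ∧ zetaResidue α β p j ≠ 0 := by
  constructor
  · rintro ⟨j, hj, h⟩
    exact ⟨j, hj, fun h0 => (zetaResidue_eq_zero_iff hβ hα j).1 h0 
      (show zetaPole α β j ∈ _ from (show s = zetaPole α β j from hj) ▸ ⟨j, hj, h⟩)⟩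
  · rintro ⟨j, rfl, h⟩
    exact not_not.1 fun h' => h ((zetaResidue_eq_zero_iff hβ hα j).2 h')

theorem ne_zetaPole_of_lt_re {j : ℕ} {s : ℂ} (hs : (1 + α) / β - j < s.re) :
    s ≠ zetaPole α β j := by
  rintro rfl
  simp [zetaPole] at hs

theorem exists_nat_lt_re (α β : ℝ) (s : ℂ) : ∃ K : ℕ, (1 + α) / β - K < s.re := by
  obtain ⟨K, hK⟩ := exists_nat_gt ((1 + α) / β - s.re)
  exact ⟨K, by rwa [sub_lt_comm]⟩

variable (hβ : 0 < β) (ha : 0 < a) (hp : 0 < a ^ β + p)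
include hβ ha hp

theorem zetaPartial_succ (K : ℕ) {s : ℂ} (hs : (1 + α) / β - K < s.re) :
    zetaPartial α β a p (K + 1) s = zetaPartial α β a p K s := by
  rw [zetaPartial, zetaPartial, Finset.sum_range_succ, zetaTerm_eq hβ.ne' (ne_zetaPole_of_lt_re hs),
    zetaRem_eq_succ_add hβ ha hp K hs]
  ring

theorem zetaPartial_eq_of_le {K L : ℕ} (hKL : K ≤ L) {s : ℂ} (hs : (1 + α) / β - K < s.re) :
    zetaPartial α β a p L s = zetaPartial α β a p K s := by
  induction L, hKL using Nat.le_induction with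
  | base => rfl
  | succ L hL ih =>
    rw [zetaPartial_succ hβ ha hp L, ih]
    have : (K : ℝ) ≤ L := by exact_mod_cast hL
    refine lt_of_le_of_lt ?_ hs
    gcongr

theorem simpleZeta_eq_zetaPartial (K : ℕ) {s : ℂ} (hs : (1 + α) / β - K < s.re) :
    simpleZeta α β a p s = zetaPartial α β a p K s := by
  have h := Nat.lt_floor_add_one ((1 + α) / β - s.re)
  rcases le_total K (⌊(1 + α) / β - s.re⌋₊ + 1) with hK | hK
  · exact zetaPartial_eq_of_le hβ ha hp hK hs
  · refine (zetaPartial_eq_of_le hβ ha hp hK ?_).symm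
    push_cast
    rw [sub_lt_comm]
    exact h

/-- The cutoff in `simpleZeta` jumps with `s`; local questions are settled with a fixed one. -/
theorem simpleZeta_eventuallyEq (K : ℕ) {s : ℂ} (hs : (1 + α) / β - K < s.re) :
    simpleZeta α β a p =ᶠ[𝓝 s] zetaPartial α β a p K := by
  filter_upwards [(isOpen_lt continuous_const Complex.continuous_re).mem_nhds hs] with w hw
  exact simpleZeta_eq_zetaPartial hβ ha hp K hw

theorem analyticAt_zetaRem (K : ℕ) {s : ℂ} (hs : (1 + α) / β - K < s.re) :
    AnalyticAt ℂ (zetaRem α β a p K) s := by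
  rw [Complex.analyticAt_iff_eventually_differentiableAt]
  filter_upwards [(isOpen_lt continuous_const Complex.continuous_re).mem_nhds hs] with w hw
  exact differentiableAt_zetaRem hβ ha hp K hw

omit hβ hp in
theorem analyticAt_zetaTerm {j : ℕ} {s : ℂ}
    (hs : s ≠ zetaPole α β j ∨ zetaResidue α β p j = 0) :
    AnalyticAt ℂ (zetaTerm α β a p j) s := by
  refine AnalyticAt.add ((differentiable_zetaTermReg α β p ha j).analyticAt s) ?_
  rcases hs with hs | hs
  · exact analyticAt_const.mul ((analyticAt_id.sub analyticAt_const).inv (sub_ne_zero.2 hs))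
  · simp only [hs, zero_mul]
    exact analyticAt_const

theorem analyticAt_simpleZeta (hα : 0 ≤ α) {s : ℂ} (hs : s ∉ simpleZetaPoles α β p) :
    AnalyticAt ℂ (simpleZeta α β a p) s := by
  obtain ⟨K, hK⟩ := exists_nat_lt_re α β s
  refine AnalyticAt.congr ?_ (simpleZeta_eventuallyEq hβ ha hp K hK).symm
  refine (analyticAt_zetaRem hβ ha hp K hK).add (Finset.analyticAt_fun_sum _ fun j _ =>
    analyticAt_zetaTerm ha ?_)
  by_contra! h
  exact hs ((mem_simpleZetaPoles_iff_exists hβ hα s).2 ⟨j, h⟩)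

theorem meromorphicOrderAt_simpleZeta (hα : 0 ≤ α) {s : ℂ} (hs : s ∈ simpleZetaPoles α β p) :
    meromorphicOrderAt (simpleZeta α β a p) s = -1 := by
  obtain ⟨j, rfl, hj⟩ := (mem_simpleZetaPoles_iff_exists hβ hα s).1 hs
  obtain ⟨K, hK⟩ := exists_nat_lt_re α β (zetaPole α β j)
  have hjK : j ∈ Finset.range K := by
    rw [Finset.mem_range]
    simp only [zetaPole, Complex.ofReal_re] at hK
    have : (j : ℝ) < K := by linarith
    exact_mod_cast this
  -- This is the function multiplied by `w - zetaPole α β j`. The points are distinct, so the other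
  -- terms are analytic here and `g` takes the nonzero residue as its value.
  set g : ℂ → ℂ := fun w => zetaResidue α β p j + (w - zetaPole α β j) *
    (zetaRem α β a p K w + zetaTermReg α β a p j w +
      ∑ i ∈ (Finset.range K).erase j, zetaTerm α β a p i w)
  have hg : AnalyticAt ℂ g (zetaPole α β j) := by
    refine analyticAt_const.add ((analyticAt_id.sub analyticAt_const).mul
      (((analyticAt_zetaRem hβ ha hp K hK).add
        ((differentiable_zetaTermReg α β p ha j).analyticAt _)).add
        (Finset.analyticAt_fun_sum _ fun i hi => analyticAt_zetaTerm ha (Or.inl ?_))))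
    exact fun h => Finset.ne_of_mem_erase hi (zetaPole_injective α β h).symm
  have heq : ∀ᶠ w in 𝓝[≠] zetaPole α β j,
      simpleZeta α β a p w = (w - zetaPole α β j) ^ (-1 : ℤ) • g w := by
    filter_upwards [(simpleZeta_eventuallyEq hβ ha hp K hK).filter_mono nhdsWithin_le_nhds,
      self_mem_nhdsWithin] with w hw hne
    have hne' : w - zetaPole α β j ≠ 0 := sub_ne_zero.2 hne
    rw [hw, zetaPartial, ← Finset.add_sum_erase _ _ hjK, zetaTerm, smul_eq_mul, zpow_neg_one]
    simp only [g]
    field_simp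
    ring
  have hm : MeromorphicAt (simpleZeta α β a p) (zetaPole α β j) := by
    refine MeromorphicAt.congr (f := fun w => (w - zetaPole α β j) ^ (-1 : ℤ) • g w) ?_
      (heq.mono fun w hw => hw.symm)
    exact (((analyticAt_id.sub analyticAt_const).meromorphicAt).zpow _).smul hg.meromorphicAt
  exact (meromorphicOrderAt_eq_int_iff hm).2 ⟨g, hg, by simpa [g] using hj, heq⟩

theorem hasSum_simpleZeta {s : ℂ} (hs : (1 + α) / β < s.re) :
    HasSum (fun n => zetaRemTerm α β a p 0 n s) (simpleZeta α β a p s) := by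
  have hs' : (1 + α) / β - (0 : ℕ) < s.re := by simpa using hs
  rw [simpleZeta_eq_zetaPartial hβ ha hp 0 hs']
  simpa [zetaPartial, zetaRem] using (summable_zetaRemTerm hβ ha hp 0 hs').hasSum
end

theorem add_rpow_add_pos {β a p : ℝ} (hβ : 0 < β) (ha : 0 < a) (hp : 0 < a ^ β + p) (n : ℕ) :
    0 < ((n : ℝ) + a) ^ β + p := by
  have : a ^ β ≤ (n + a) ^ β :=
    Real.rpow_le_rpow ha.le (by have := n.cast_nonneg (α := ℝ); linarith) hβ.le
  linarith

theorem isSimpleZeta_simpleZeta {α β x p : ℝ} (hα : 0 ≤ α) (hβ : 0 < β) (ha : 0 < x + 1)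
    (hp : 0 < (x + 1) ^ β + p) : IsSimpleZeta α β x p (simpleZeta α β (x + 1) p) where
  hasSum s hs := by
    refine (hasSum_simpleZeta hβ ha hp hs).congr_fun fun n => ?_
    rw [zetaRemTerm_zero ha (add_rpow_add_pos hβ ha hp n), simpleZetaTerm]
    push_cast
    rw [add_right_comm, add_assoc]
  analyticAt s hs := analyticAt_simpleZeta hβ ha hp hα hs
  simplePole s hs := meromorphicOrderAt_simpleZeta hβ ha hp hα hs

theorem countable_simpleZetaPoles (α β p : ℝ) : (simpleZetaPoles α β p).Countable := by
  refine (countable_range fun j : ℕ => (((1 + α) / β - j : ℝ) : ℂ)).mono ?_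
  rintro s ⟨j, hj, -⟩
  exact ⟨j, hj.symm⟩

theorem zero_notMem_simpleZetaPoles (α β p : ℝ) : (0 : ℂ) ∉ simpleZetaPoles α β p := by
  rintro ⟨j, -, h, -⟩
  exact h 0 (by simp)

/-- The analytic continuation is unique outside the poles. -/
theorem IsSimpleZeta.eventuallyEq_zero {α β x p : ℝ} {Z W : ℂ → ℂ} (hZ : IsSimpleZeta α β x p Z)
    (hW : IsSimpleZeta α β x p W) : Z =ᶠ[𝓝 0] W := by
  set S := simpleZetaPoles α β p
  have hconn : IsPreconnected Sᶜ :=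
    ((countable_simpleZetaPoles α β p).isConnected_compl_of_one_lt_rank (by simp)).isPreconnected
  set z₀ : ℂ := (((1 + α) / β + 1 : ℝ) : ℂ)
  have hev {z : ℂ} (hz : (1 + α) / β < z.re) : Z z = W z :=
    (hZ.hasSum z hz).unique (hW.hasSum z hz)
  have hz₀ : (1 + α) / β < z₀.re := by simp [z₀]
  have hmem : z₀ ∈ Sᶜ := by
    rintro ⟨j, hj, -⟩
    have h1 : (1 + α) / β + 1 = (1 + α) / β - j := Complex.ofReal_injective hj
    have := j.cast_nonneg (α := ℝ)
    linarith
  have key := AnalyticOnNhd.eqOn_of_preconnected_of_eventuallyEq (fun z hz => hZ.analyticAt z hz)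
    (fun z hz => hW.analyticAt z hz) hconn hmem (by
      filter_upwards [(isOpen_lt continuous_const Complex.continuous_re).mem_nhds hz₀] with w hw
      exact hev hw)
  have h0 := zero_notMem_simpleZetaPoles α β p
  -- For analytic functions, agreement at points accumulating at `0` suffices. Density of the
  -- complement of a countable set provides them, without showing the pole set closed.
  refine ((hZ.analyticAt 0 h0).frequently_eq_iff_eventually_eq (hW.analyticAt 0 h0)).1 ?_
  have hd : Dense (S ∪ {0})ᶜ :=
    ((countable_simpleZetaPoles α β p).union (countable_singleton 0)).dense_compl ℝ
  rw [frequently_nhdsWithin_iff]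
  refine (mem_closure_iff_frequently.1 (hd 0)).mono fun z hz => ?_
  rw [compl_union] at hz
  exact ⟨key hz.1, hz.2⟩

/-! ### Values and derivatives at `s = 0` -/

theorem sum_Icc_one_eq_sum_range {M : Type*} [AddCommMonoid M] (f : ℕ → M) (n : ℕ) :
    ∑ j ∈ Finset.Icc 1 n, f j = ∑ j ∈ Finset.range n, f (j + 1) := by
  induction n with
  | zero => simp
  | succ n ih => rw [Finset.sum_Icc_succ_top (by omega), ih, Finset.sum_range_succ]

theorem negBinom_one (j : ℕ) : negBinom j 1 = (-1) ^ j := by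
  induction j with
  | zero => simp
  | succ j ih =>
    have h1 : (j.factorial : ℂ) ≠ 0 := by exact_mod_cast j.factorial_ne_zero
    have h2 : (j + 1 : ℂ) ≠ 0 := by exact_mod_cast j.succ_ne_zero
    rw [negBinom, div_eq_iff h1] at ih
    rw [negBinom, Finset.prod_range_succ, ih, Nat.factorial_succ]
    push_cast
    field_simp
    ring

theorem negBinom_succ' (j : ℕ) (s : ℂ) :
    negBinom (j + 1) s = negBinom j s * (-(s + j) / (j + 1)) := by
  have h1 : (j.factorial : ℂ) ≠ 0 := by exact_mod_cast j.factorial_ne_zero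
  have h2 : (j + 1 : ℂ) ≠ 0 := by exact_mod_cast j.succ_ne_zero
  rw [negBinom, negBinom, Finset.prod_range_succ, Nat.factorial_succ]
  push_cast
  field_simp

/-- Each factor `-(s + i)/(i + 1)` has logarithmic derivative `1/(i + 1)` at `1`. This harmonic sum
later becomes `γ + Ψ(q)`. -/
theorem hasDerivAt_negBinom_one (j : ℕ) :
    HasDerivAt (negBinom j) ((-1) ^ j * ∑ i ∈ Finset.range j, ((i : ℂ) + 1)⁻¹) 1 := by
  induction j with
  | zero =>
    have : negBinom 0 = fun _ => 1 := funext negBinom_zero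
    simpa [this] using hasDerivAt_const (1 : ℂ) (1 : ℂ)
  | succ j ih =>
    have h2 : (j + 1 : ℂ) ≠ 0 := by exact_mod_cast j.succ_ne_zero
    have h := ih.fun_mul ((((hasDerivAt_id (1 : ℂ)).add_const (j : ℂ)).fun_neg).div_const (j + 1 : ℂ))
    rw [show negBinom (j + 1) = fun s => negBinom j s * (-(id s + j) / (j + 1)) from
      funext fun s => negBinom_succ' j s]
    refine h.congr_deriv ?_
    rw [Finset.sum_range_succ, negBinom_one, id]
    field_simp
    ring

theorem negBinom_succ_eq_mul (j : ℕ) (s : ℂ) :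
    negBinom (j + 1) s = s * (-negBinom j (s + 1) / (j + 1)) := by
  have h2 : (j + 1 : ℂ) ≠ 0 := by exact_mod_cast j.succ_ne_zero
  rw [eq_comm, ← mul_div_assoc, div_eq_iff h2, negBinom_succ]
  ring

theorem negBinom_succ_zero (j : ℕ) : negBinom (j + 1) 0 = 0 := by
  rw [negBinom_succ_eq_mul, zero_mul]

theorem hasDerivAt_negBinom_succ_zero (j : ℕ) :
    HasDerivAt (negBinom (j + 1)) ((-1) ^ (j + 1) / ((j + 1 : ℕ) : ℂ)) 0 := by
  have h1 : DifferentiableAt ℂ (fun s => -negBinom j (s + 1) / (j + 1)) 0 := by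
    have := differentiable_negBinom j
    fun_prop
  have h := (hasDerivAt_id (0 : ℂ)).fun_mul h1.hasDerivAt
  rw [show negBinom (j + 1) = fun s => id s * (-negBinom j (s + 1) / (j + 1)) from
    funext fun s => negBinom_succ_eq_mul j s]
  refine h.congr_deriv ?_
  simp [negBinom_one, pow_succ]

theorem dslope_negBinom_succ_zero (j : ℕ) :
    dslope (negBinom (j + 1)) 0 = fun s => -negBinom j (s + 1) / (j + 1) := by
  funext s
  by_cases hs : s = 0
  · subst hs
    rw [dslope_same, (hasDerivAt_negBinom_succ_zero j).deriv]
    simp [negBinom_one, pow_succ]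
  · rw [dslope_of_ne _ hs, slope_def_field, negBinom_succ_zero, negBinom_succ_eq_mul]
    field_simp
    ring

/-- This is the second Taylor coefficient of `binom(-s, j + 1)` at `0`, read off from the derivative
at `1` after the factor `s` is removed. -/
theorem hasDerivAt_dslope_negBinom (j : ℕ) :
    HasDerivAt (dslope (negBinom (j + 1)) 0)
      ((-1) ^ (j + 1) / ((j + 1 : ℕ) : ℂ) * ∑ i ∈ Finset.range j, ((i : ℂ) + 1)⁻¹) 0 := by
  rw [dslope_negBinom_succ_zero]
  have h := hasDerivAt_negBinom_one j
  rw [← zero_add (1 : ℂ)] at h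
  refine ((h.comp_add_const 0 1).fun_neg.div_const (j + 1 : ℂ)).congr_deriv ?_
  push_cast
  rw [pow_succ]
  simp only [zero_add]
  ring

theorem binomRem_succ_apply_zero (q : ℕ) (u : ℝ) : binomRem (q + 1) 0 u = 0 := by
  simp [binomRem, Finset.sum_range_succ', negBinom_succ_zero]

theorem hasDerivAt_binomRem_zero (q : ℕ) {u : ℝ} (hu : -1 < u) :
    HasDerivAt (fun s => binomRem (q + 1) s u)
      (-(Real.log (1 + u) + ∑ j ∈ Finset.Icc 1 q, (-1 : ℝ) ^ j / j * u ^ j : ℝ) : ℂ) 0 := by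
  have hpos : 0 < 1 + u := by linarith
  have h : ((1 + u : ℝ) : ℂ) ≠ 0 := by exact_mod_cast hpos.ne'
  have h1 : HasDerivAt (fun s : ℂ => ((1 + u : ℝ) : ℂ) ^ (-s)) _ 0 :=
    (hasDerivAt_neg (0 : ℂ)).const_cpow (Or.inl h)
  have h2 : HasDerivAt (fun s : ℂ => ∑ j ∈ Finset.range q, negBinom (j + 1) s * (u : ℂ) ^ (j + 1)) _ 0 :=
    HasDerivAt.fun_sum fun j _ => (hasDerivAt_negBinom_succ_zero j).mul_const _
  have h3 := h1.fun_sub (h2.add_const 1)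
  simp only [binomRem, Finset.sum_range_succ']
  simp only [negBinom_zero, pow_zero, mul_one]
  refine h3.congr_deriv ?_
  rw [sum_Icc_one_eq_sum_range]
  push_cast
  rw [← Complex.ofReal_one, ← Complex.ofReal_add, Complex.ofReal_log hpos.le]
  simp
  ring

section
variable {α β a p x : ℝ}

theorem simpleZetaFactor_succ_eq_exp (q n : ℕ) (hb : 0 < (n : ℝ) + (x + 1))
    (hu : -1 < p / (n + (x + 1)) ^ β) :
    simpleZetaFactor α β x p q (n + 1) = Real.exp ((n + (x + 1)) ^ α *
      (Real.log (1 + p / (n + (x + 1)) ^ β) +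
        ∑ j ∈ Finset.Icc 1 q, (-1 : ℝ) ^ j / j * (p / (n + (x + 1)) ^ β) ^ j)) := by
  have h1 : ((n + 1 : ℕ) : ℝ) + x = n + (x + 1) := by push_cast; ring
  rw [simpleZetaFactor, h1, mul_add, Real.exp_add, Real.rpow_def_of_pos (by linarith), mul_comm (Real.log _)]
  congr 3
  refine Finset.sum_congr rfl fun j _ => ?_
  rw [div_pow, Real.rpow_mul hb.le, Real.rpow_natCast]

theorem zetaRem_succ_apply_zero (α β a p : ℝ) (q : ℕ) : zetaRem α β a p (q + 1) 0 = 0 := by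
  simp [zetaRem, zetaRemTerm, binomRem_succ_apply_zero]

/-- The bound on `q` puts `0` in the half plane of the remainder with `q + 1` terms. Its termwise
derivatives at `0` are minus the logarithms of the factors, so their summability also yields
convergence of the product. -/
theorem tprod_simpleZetaFactor (hβ : 0 < β) (ha : 0 < x + 1) (hp : 0 < (x + 1) ^ β + p) {q : ℕ}
    (hq : (1 + α) / β < q + 1) :
    (Multipliable (fun n : ℕ => simpleZetaFactor α β x p q (n + 1)) ∧
      0 < ∏' n : ℕ, simpleZetaFactor α β x p q (n + 1)) ∧
    deriv (zetaRem α β (x + 1) p (q + 1)) 0 =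
      -(Real.log (∏' n : ℕ, simpleZetaFactor α β x p q (n + 1)) : ℂ) := by
  set v : ℕ → ℝ := fun n => (n + (x + 1)) ^ α * (Real.log (1 + p / (n + (x + 1)) ^ β) +
        ∑ j ∈ Finset.Icc 1 q, (-1 : ℝ) ^ j / j * (p / (n + (x + 1)) ^ β) ^ j) with hv
  have hderiv (n : ℕ) : deriv (zetaRemTerm α β (x + 1) p (q + 1) n) 0 = ((-v n : ℝ) : ℂ) := by
    have hb := natCast_add_pos ha n
    have hb' : ((n + (x + 1) : ℝ) : ℂ) ≠ 0 := by exact_mod_cast hb.ne'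
    have h1 := hasDerivAt_binomRem_zero q (neg_one_lt_div_add_rpow hβ ha hp n)
    have h2 : DifferentiableAt ℂ (fun s : ℂ => ((n + (x + 1) : ℝ) : ℂ) ^ ((α : ℂ) - β * s)) 0 :=
      DifferentiableAt.const_cpow (by fun_prop) (Or.inl hb')
    have h3 := (h2.hasDerivAt.fun_mul h1).deriv
    rw [show zetaRemTerm α β (x + 1) p (q + 1) n = fun s =>
      ((n + (x + 1) : ℝ) : ℂ) ^ ((α : ℂ) - β * s) *
        binomRem (q + 1) s (p / (n + (x + 1)) ^ β) from rfl, h3, binomRem_succ_apply_zero,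
      mul_zero, mul_zero, zero_add, sub_zero, ← Complex.ofReal_cpow hb.le, hv]
    rw [Complex.ofReal_neg, Complex.ofReal_mul, mul_neg]
  have h1 := hasSum_deriv_zetaRem (α := α) hβ ha hp (q + 1) (s := 0) (by push_cast; simp; linarith)
  simp only [hderiv] at h1
  have hsum : Summable v := by
    have := h1.summable
    rw [Complex.summable_ofReal] at this
    simpa using this.neg
  have h2 : deriv (zetaRem α β (x + 1) p (q + 1)) 0 = ((-∑' n, v n : ℝ) : ℂ) :=
    h1.unique (Complex.hasSum_ofReal.2 hsum.hasSum.neg)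
  have hprod : HasProd (fun n : ℕ => simpleZetaFactor α β x p q (n + 1)) (Real.exp (∑' n, v n)) := by
    have h3 : (fun n : ℕ => simpleZetaFactor α β x p q (n + 1)) = Real.exp ∘ v := funext fun n =>
      simpleZetaFactor_succ_eq_exp q n (natCast_add_pos ha n) (neg_one_lt_div_add_rpow hβ ha hp n)
    rw [h3]
    exact hsum.hasSum.rexp
  rw [h2, hprod.tprod_eq, Real.log_exp]
  exact ⟨⟨hprod.multipliable, Real.exp_pos _⟩, by push_cast; rfl⟩

theorem zetaTerm_eventuallyEq (hβ : β ≠ 0) {j : ℕ} {s : ℂ} (hs : s ≠ zetaPole α β j) :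
    zetaTerm α β a p j =ᶠ[𝓝 s]
      fun s => p ^ j * negBinom j s * hurwitzZetaPos (β * (s + j) - α) a := by
  filter_upwards [isOpen_ne.mem_nhds hs] with w hw
  exact zetaTerm_eq hβ hw

theorem hasDerivAt_zetaTerm_zero (hα : 0 ≤ α) (hβ : 0 < β) :
    zetaTerm α β a p 0 0 = hurwitzZetaPos (-α) a ∧
    HasDerivAt (zetaTerm α β a p 0) (β * deriv (fun s => hurwitzZetaPos s a) (-α)) 0 := by
  have hl : 0 < (1 + α) / β := by positivity
  have h0 : (0 : ℂ) ≠ zetaPole α β 0 := by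
    rw [zetaPole]
    exact_mod_cast (by simpa using hl.ne)
  refine ⟨by simp [zetaTerm_eq hβ.ne' h0], ?_⟩
  have h1 : (-α : ℂ) ≠ 1 := by
    intro h
    have : -α = 1 := by exact_mod_cast h
    linarith
  have h2 : HasDerivAt (fun s : ℂ => β * (s + (0 : ℕ)) - α) (β : ℂ) 0 := by
    simpa using ((((hasDerivAt_id (0 : ℂ)).add_const ((0 : ℕ) : ℂ)).const_mul (β : ℂ)).sub_const (α : ℂ))
  have h3 : HasDerivAt (fun s => hurwitzZetaPos s a) (deriv (fun s => hurwitzZetaPos s a) (-α))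
      (β * ((0 : ℂ) + (0 : ℕ)) - α) := by
    simpa using (differentiableAt_hurwitzZetaPos a h1).hasDerivAt
  refine HasDerivAt.congr_of_eventuallyEq ?_ (zetaTerm_eventuallyEq hβ.ne' h0)
  simpa [Function.comp_def, mul_comm] using h3.comp 0 h2

/-- The binomial factor vanishes at `0` and the Hurwitz factor is regular, so only the derivative of
the former survives the product rule. -/
theorem hasDerivAt_zetaTerm_succ (hβ : 0 < β) {j : ℕ} (hj : (1 + α) / β ≠ (j + 1 : ℕ)) :
    zetaTerm α β a p (j + 1) 0 = 0 ∧
    HasDerivAt (zetaTerm α β a p (j + 1)) ((-1) ^ (j + 1) / ((j + 1 : ℕ) : ℂ) *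
      hurwitzZetaPos (β * (j + 1 : ℕ) - α) a * p ^ (j + 1)) 0 := by
  have h0 : (0 : ℂ) ≠ zetaPole α β (j + 1) := by
    rw [zetaPole]
    exact_mod_cast (sub_ne_zero.2 hj).symm
  refine ⟨by simp [zetaTerm_eq hβ.ne' h0, negBinom_succ_zero], ?_⟩
  have h1 : (β * (0 + (j + 1 : ℕ)) - α : ℂ) ≠ 1 := by
    rw [← sub_ne_zero, mul_sub_zetaPole hβ.ne']
    exact mul_ne_zero (by exact_mod_cast hβ.ne') (sub_ne_zero.2 h0)
  have h2 : DifferentiableAt ℂ (fun s : ℂ => hurwitzZetaPos (β * (s + (j + 1 : ℕ)) - α) a) 0 :=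
    DifferentiableAt.comp (g := fun s => hurwitzZetaPos s a) (0 : ℂ)
      (differentiableAt_hurwitzZetaPos a h1) (by fun_prop)
  refine HasDerivAt.congr_of_eventuallyEq ?_ (zetaTerm_eventuallyEq hβ.ne' h0)
  refine (((hasDerivAt_negBinom_succ_zero j).const_mul _).fun_mul h2.hasDerivAt).congr_deriv ?_
  rw [negBinom_succ_zero, zero_add]
  ring

/-- Here the pole sits at `0` with zero residue. The value is `β⁻¹` times the slope of the binomial,
with `(j + 1) β = α + 1`. In the derivative, the regular Hurwitz part at `1` gives `-Ψ(a)` and the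
difference quotient gives the harmonic sum. -/
theorem hasDerivAt_zetaTerm_pole (hβ : 0 < β) (ha : 0 < a) {j : ℕ}
    (hj : (1 + α) / β = (j + 1 : ℕ)) :
    zetaTerm α β a p (j + 1) 0 = (-1) ^ (j + 1) / (α + 1) * p ^ (j + 1) ∧
    HasDerivAt (zetaTerm α β a p (j + 1)) ((-1) ^ (j + 1) / ((j + 1 : ℕ) : ℂ) *
      (-Complex.digamma a + (Real.eulerMascheroniConstant + Complex.digamma ((j + 1 : ℕ) : ℂ)) *
        (1 / β)) * p ^ (j + 1)) 0 := by
  have hβ' : (β : ℂ) ≠ 0 := by exact_mod_cast hβ.ne'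
  have h2 : (j + 1 : ℂ) ≠ 0 := by exact_mod_cast j.succ_ne_zero
  have hpole : zetaPole α β (j + 1) = 0 := by simp [zetaPole, hj]
  have hα : (α + 1 : ℂ) = (j + 1) * β := by
    rw [div_eq_iff hβ.ne'] at hj
    have : α + 1 = (j + 1 : ℕ) * β := by linarith
    exact_mod_cast this
  have hres : zetaResidue α β p (j + 1) = 0 := by
    rw [zetaResidue, hpole, negBinom_succ_zero, mul_zero]
  have hfun : zetaTerm α β a p (j + 1) = fun s => p ^ (j + 1) * (negBinom (j + 1) s *
      hurwitzZetaReg a (β * s + 1) + (β : ℂ)⁻¹ * dslope (negBinom (j + 1)) 0 s) := by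
    funext s
    have h3 : (β * (s + (j + 1 : ℕ)) - α : ℂ) = β * s + 1 := by
      rw [← sub_eq_iff_eq_add, mul_sub_zetaPole hβ.ne', hpole, sub_zero]
    rw [zetaTerm, hres, zero_mul, add_zero, zetaTermReg, hpole, h3]
  have hdig : Complex.digamma ((j + 1 : ℕ) : ℂ) =
      -Real.eulerMascheroniConstant + ∑ i ∈ Finset.range j, ((i : ℂ) + 1)⁻¹ := by
    have := Complex.digamma_add_natCast one_pos j
    rw [Complex.ofReal_one, Complex.digamma_one] at this
    rw [← this, Nat.cast_succ, add_comm]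
  rw [hfun]
  constructor
  · simp only [negBinom_succ_zero, dslope_same, (hasDerivAt_negBinom_succ_zero j).deriv, hα]
    push_cast
    field_simp
    ring
  · have h4 : DifferentiableAt ℂ (fun s : ℂ => hurwitzZetaReg a (β * s + 1)) 0 :=
      ((differentiable_hurwitzZetaReg ha).comp (by fun_prop)) 0
    refine ((((hasDerivAt_negBinom_succ_zero j).fun_mul h4.hasDerivAt).fun_add
      ((hasDerivAt_dslope_negBinom j).const_mul (β : ℂ)⁻¹)).const_mul _).congr_deriv ?_
    rw [negBinom_succ_zero, hdig]
    simp only [mul_zero, zero_add, hurwitzZetaReg, if_true, zero_mul, add_zero]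
    ring

/-- The derivatives `d j` are left abstract so that one statement covers both the regular case and
the case of a cancelled pole. -/
theorem hasDerivAt_simpleZeta_zero (hα : 0 ≤ α) (hβ : 0 < β) (ha : 0 < a) (hp : 0 < a ^ β + p)
    {q : ℕ} (hq : (1 + α) / β < q + 1) {d : ℕ → ℂ}
    (hd : ∀ j < q, HasDerivAt (zetaTerm α β a p (j + 1)) (d j) 0) :
    simpleZeta α β a p 0 = hurwitzZetaPos (-α) a +
      ∑ j ∈ Finset.range q, zetaTerm α β a p (j + 1) 0 ∧
    deriv (simpleZeta α β a p) 0 = β * deriv (fun s => hurwitzZetaPos s a) (-α) +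
      ∑ j ∈ Finset.range q, d j + deriv (zetaRem α β a p (q + 1)) 0 := by
  have hs : (1 + α) / β - (q + 1 : ℕ) < (0 : ℂ).re := by
    push_cast
    simpa using hq
  have hev := simpleZeta_eventuallyEq hβ ha hp (q + 1) hs
  obtain ⟨h0, h0'⟩ := hasDerivAt_zetaTerm_zero (a := a) (p := p) hα hβ
  constructor
  · rw [hev.self_of_nhds, zetaPartial, zetaRem_succ_apply_zero, Finset.sum_range_succ', h0]
    ring
  · rw [hev.deriv_eq]
    have h1 := (differentiableAt_zetaRem hβ ha hp (q + 1) hs).hasDerivAt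
    have h2 := HasDerivAt.fun_sum (u := Finset.range q) fun j hj => hd j (Finset.mem_range.1 hj)
    have h3 := h1.fun_add (h2.fun_add h0')
    have h4 : zetaPartial α β a p (q + 1) = fun s => zetaRem α β a p (q + 1) s +
        (∑ j ∈ Finset.range q, zetaTerm α β a p (j + 1) s + zetaTerm α β a p 0 s) := by
      funext s
      rw [zetaPartial, Finset.sum_range_succ']
    rw [h4, h3.deriv]
    ring
end

theorem propositions3 (α β x p : ℝ) (hα : 0 ≤ α) (hβ : 0 < β)
    (hx : ∀ n : ℕ, 1 ≤ n → 0 < (n : ℝ) + x)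
    (hp : ∀ n : ℕ, 1 ≤ n → 0 < ((n : ℝ) + x) ^ β + p) :
    (∃ Z : ℂ → ℂ, IsSimpleZeta α β x p Z) ∧
    ∀ Z : ℂ → ℂ, IsSimpleZeta α β x p Z →
      AnalyticAt ℂ Z 0 ∧
      -- the case where `(1 + α)/β` is not a positive integer
      ((∀ q : ℕ, 1 ≤ q → (1 + α) / β ≠ q) →
        (Multipliable (fun n : ℕ => simpleZetaFactor α β x p ⌊(α + 1) / β⌋₊ (n + 1)) ∧
          0 < ∏' n : ℕ, simpleZetaFactor α β x p ⌊(α + 1) / β⌋₊ (n + 1)) ∧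
        Z 0 = hurwitzZetaPos (-(α : ℂ)) (x + 1) ∧
        deriv Z 0 =
          (β : ℂ) * deriv (fun s : ℂ => hurwitzZetaPos s (x + 1)) (-(α : ℂ))
          + ∑ j ∈ Finset.Icc 1 ⌊(α + 1) / β⌋₊,
              (-1 : ℂ) ^ j / (j : ℂ) * hurwitzZetaPos ((β : ℂ) * j - α) (x + 1) * (p : ℂ) ^ j
          - (Real.log (∏' n : ℕ, simpleZetaFactor α β x p ⌊(α + 1) / β⌋₊ (n + 1)) : ℂ)) ∧
      -- the case where `(1 + α)/β` is a positive integer `q`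
      (∀ q : ℕ, 1 ≤ q → (1 + α) / β = q →
        (Multipliable (fun n : ℕ => simpleZetaFactor α β x p q (n + 1)) ∧
          0 < ∏' n : ℕ, simpleZetaFactor α β x p q (n + 1)) ∧
        Z 0 = hurwitzZetaPos (-(α : ℂ)) (x + 1)
          + (-1 : ℂ) ^ q / ((α : ℂ) + 1) * (p : ℂ) ^ q ∧
        deriv Z 0 =
          (β : ℂ) * deriv (fun s : ℂ => hurwitzZetaPos s (x + 1)) (-(α : ℂ))
          + ∑ j ∈ Finset.Icc 1 (q - 1),
              (-1 : ℂ) ^ j / (j : ℂ) * hurwitzZetaPos ((β : ℂ) * j - α) (x + 1) * (p : ℂ) ^ j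
          + (-1 : ℂ) ^ q / (q : ℂ) *
              (-Complex.digamma ((x : ℂ) + 1)
                + ((Real.eulerMascheroniConstant : ℂ) + Complex.digamma (q : ℂ)) * (1 / (β : ℂ)))
              * (p : ℂ) ^ q
          - (Real.log (∏' n : ℕ, simpleZetaFactor α β x p q (n + 1)) : ℂ)) := by
  have ha : 0 < x + 1 := by
    have := hx 1 le_rfl
    push_cast at this
    linarith
  have hp' : 0 < (x + 1) ^ β + p := by
    have := hp 1 le_rfl
    rwa [Nat.cast_one, add_comm (1 : ℝ)] at this
  have hcast : ((x + 1 : ℝ) : ℂ) = x + 1 := by push_cast; rfl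
  have hW := isSimpleZeta_simpleZeta hα hβ ha hp'
  refine ⟨⟨_, hW⟩, fun Z hZ => ?_⟩
  have hev := hZ.eventuallyEq_zero hW
  refine ⟨hZ.analyticAt 0 (zero_notMem_simpleZetaPoles α β p), fun hne => ?_, fun q hq1 hq => ?_⟩
  · have hq : (1 + α) / β < ⌊(α + 1) / β⌋₊ + 1 := by
      rw [add_comm (1 : ℝ) α]
      exact Nat.lt_floor_add_one _
    -- Only the upper bound from the floor is needed; `q = 0` is allowed.
    generalize ⌊(α + 1) / β⌋₊ = q at hq ⊢
    have hterm (j : ℕ) := hasDerivAt_zetaTerm_succ (a := x + 1) (p := p) hβ (hne (j + 1) (by omega))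
    obtain ⟨h1, h2⟩ := hasDerivAt_simpleZeta_zero hα hβ ha hp' hq fun j _ => (hterm j).2
    obtain ⟨h3, h4⟩ := tprod_simpleZetaFactor hβ ha hp' hq
    refine ⟨h3, ?_, ?_⟩
    · rw [hev.self_of_nhds, h1, Finset.sum_eq_zero fun j _ => (hterm j).1, add_zero]
    · rw [hev.deriv_eq, h2, h4, sum_Icc_one_eq_sum_range, ← sub_eq_add_neg]
  -- Among the terms indexed by `j + 1`, those with `j < m` are regular at `0`; only the last, `j =
  -- m`, has its pole there.
  · obtain ⟨m, rfl⟩ : ∃ m, q = m + 1 := ⟨q - 1, by omega⟩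
    have hq' : (1 + α) / β < (m + 1 : ℕ) + 1 := by rw [hq]; linarith
    have hterm (j : ℕ) (hj : j < m) := hasDerivAt_zetaTerm_succ (a := x + 1) (p := p) hβ
      (j := j) (by
        rw [hq]
        exact_mod_cast (by omega : m + 1 ≠ j + 1))
    obtain ⟨h5, h6⟩ := hasDerivAt_zetaTerm_pole (p := p) hβ ha hq
    obtain ⟨h1, h2⟩ := hasDerivAt_simpleZeta_zero (d := fun j => deriv (zetaTerm α β (x + 1) p (j + 1)) 0)
      hα hβ ha hp' hq' fun j hj => by
        rcases (Nat.lt_succ_iff_lt_or_eq.1 hj) with hj | rfl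
        · exact (hterm j hj).2.differentiableAt.hasDerivAt
        · exact h6.differentiableAt.hasDerivAt
    obtain ⟨h3, h4⟩ := tprod_simpleZetaFactor hβ ha hp' hq'
    refine ⟨h3, ?_, ?_⟩
    · rw [hev.self_of_nhds, h1, Finset.sum_range_succ,
        Finset.sum_eq_zero fun j hj => (hterm j (Finset.mem_range.1 hj)).1, zero_add, h5]
    · rw [hev.deriv_eq, h2, h4, Finset.sum_range_succ, h6.deriv, hcast,
        Finset.sum_congr rfl fun j hj => (hterm j (Finset.mem_range.1 hj)).2.deriv,
        Nat.add_sub_cancel, sum_Icc_one_eq_sum_range]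
      ring
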